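/- Let $q \in [2,\infty)$, let $(\mathcal X,\mathcal A,\mu)$ be a measure space, and let $\mathbb L^q=\mathbb L^q(\mathcal X,\mathcal A,\mu)$ be the space of real-valued $q$-integrable functions with its norm $|\cdot|_q$. On a probability space $(\Omega,\mathcal F,\mathbb P)$ let $(d_i)_{i\ge1}$ be a sequence of $\mathbb L^q$-valued martingale differences with respect to a filtration $(\mathcal F_i)$, that is, each $d_i$ is (strongly) $\mathcal F_i$-measurable and Bochner integrable, and $\mathbb E(d_{i+1}\mid\mathcal F_i)=0$ almost surely for all $i\ge1$. Assume that there is a real $b>0$ such that $\Vert\,|d_i|_q\,\Vert_\infty\le b$ for all $i\ge1$, and put $M_k=\sum_{i=1}^k d_i$. Then for every integer $n\ge1$ and every real $x>0$, $$\mathbb P\Big(\max_{1\le k\le n}|M_k|_q\ge x\Big)\le B_q(b,n,x):=\begin{cases}1 & \text{if } x<b\sqrt{(q-1)n},\\[2pt] \dfrac{(b^2(q-1)n)^{q/2}}{x^q} & \text{if } b\sqrt{(q-1)n}\le x<b\sqrt{e(q-1)n},\\[6pt] \dfrac1{\sqrt e}\exp\Big(-\dfrac{x^2}{2eb^2n}\Big)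 & \text{if } x\ge b\sqrt{e(q-1)n}.\end{cases}$$ Moreover, if $q\ge e+1$, then this bound is always better than the bound of Pinelis: for every integer $n\ge1$ and every real $x>0$, $$B_q(b,n,x)<2\exp\Big(-\frac{x^2}{2(q-1)b^2n}\Big).$$ -/

import Mathlib

open MeasureTheory

/-- The exponent `q ∈ [2, ∞)` makes `Lp ℝ q μ` a Banach space. -/
instance fact_one_le_ofReal (q : ℝ) [hq : Fact (2 ≤ q)] :
    Fact ((1 : ENNReal) ≤ ENNReal.ofReal q) :=
  ⟨by
    rw [← ENNReal.ofReal_one]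
    exact ENNReal.ofReal_le_ofReal (one_le_two.trans hq.out)⟩

/-- `(d i)`, `i ≥ 1`, is a sequence of martingale differences with values in the Banach space `E`
with respect to the filtration `(ℱ i)`: each `d i` is `ℱ i`-measurable and (Bochner) integrable,
and `𝔼[d (i + 1) | ℱ i] = 0` almost surely. The index `0` plays no role. -/
structure IsMartingaleDifference {Ω E : Type*} {mΩ : MeasurableSpace Ω}
    [NormedAddCommGroup E] [NormedSpace ℝ E] [CompleteSpace E]
    (d : ℕ → Ω → E) (ℱ : Filtration ℕ mΩ) (P : Measure Ω) : Prop where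
  stronglyMeasurable : ∀ i, 1 ≤ i → StronglyMeasurable[ℱ i] (d i)
  integrable : ∀ i, 1 ≤ i → Integrable (d i) P
  condExp_eq_zero : ∀ i, 1 ≤ i → P[d (i + 1) | ℱ i] =ᵐ[P] 0

/-- The partial sum `M k = d 1 + ⋯ + d k`. -/
def partialSum {Ω E : Type*} [AddCommMonoid E] (d : ℕ → Ω → E) (k : ℕ) (ω : Ω) : E :=
  ∑ i ∈ Finset.Icc 1 k, d i ω

/-- The three-regime deviation bound. -/
noncomputable def threeRegimeBound (q b : ℝ) (n : ℕ) (x : ℝ) : ℝ :=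
  if x < b * √((q - 1) * n) then 1
  else if x < b * √(Real.exp 1 * (q - 1) * n) then (b ^ 2 * (q - 1) * n) ^ (q / 2) / x ^ q
  else 1 / √(Real.exp 1) * Real.exp (-(x ^ 2 / (2 * Real.exp 1 * b ^ 2 * n)))

/-- Pinelis' deviation bound. -/
noncomputable def pinelisBound (q b : ℝ) (n : ℕ) (x : ℝ) : ℝ :=
  2 * Real.exp (-(x ^ 2 / (2 * (q - 1) * b ^ 2 * n)))

/-!
The inequality `‖x + y‖ ^ p + ‖x - y‖ ^ p ≤ 2 * (‖x‖ ^ 2 + (p - 1) * ‖y‖ ^ 2) ^ (p / 2)` holds in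
`ℝ`, hence by convexity in every real inner product space and, by two applications of the triangle
inequality (in `ℓ^{p / q}` and in `L^{q / 2}`), in the `L^q` spaces with `2 ≤ q ≤ p`. Taking a
further `L^p` space, over `Ω`, it says that `L^p(Ω; L^q)` is 2-smooth with constant `p - 1`.

Conditional expectation is a contraction of `L^p(Ω; L^q)`, so `M_k` is Birkhoff orthogonal to
`d_{k + 1}`. In a 2-smooth space this gives `‖M_{k + 1}‖_p² ≤ ‖M_k‖_p² + (p - 1) ‖d_{k + 1}‖_p²`,
so that `‖M_n‖_p² ≤ (p - 1) b² n`. Doob's inequality for the submartingale `|M_k|_q ^ p` then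
bounds the probability by `(b² (p - 1) n) ^ (p / 2) / x ^ p` for every `p ≥ q`. The middle regime is
`p = q`, and the last one is `p = 1 + x² / (e b² n)`.

In terms of `u = x² / ((q - 1) b² n)` the comparison with the bound of Pinelis reduces to
`u - 1 ≤ 3 log u` on `[1, 3]` for the middle regime and to `e ≤ q - 1` for the last one.
-/

theorem sq_rpow_half {a : ℝ} (ha : 0 ≤ a) (p : ℝ) : (a ^ 2) ^ (p / 2) = a ^ p := by
  rw [← Real.rpow_natCast_mul ha, Nat.cast_ofNat, mul_div_cancel₀ p two_ne_zero]

theorem convexOn_add_sub_le {f : ℝ → ℝ} {S : Set ℝ} (hf : ConvexOn ℝ S f) {a s t : ℝ}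
    (hst : |s| ≤ t) (hadd : a + t ∈ S) (hsub : a - t ∈ S) :
    f (a + s) + f (a - s) ≤ f (a + t) + f (a - t) := by
  obtain rfl | ht := ((abs_nonneg s).trans hst).eq_or_lt
  · simp [abs_nonpos_iff.1 hst]
  obtain ⟨hl, hr⟩ := abs_le.1 hst
  set w := (t + s) / (2 * t) with hw
  have hw0 : 0 ≤ w := div_nonneg (by linarith) (by positivity)
  have hw1 : 0 ≤ 1 - w := sub_nonneg.2 <| (div_le_one (by positivity)).2 (by linarith)
  have hplus : w * (a + t) + (1 - w) * (a - t) = a + s := by rw [hw]; field_simp; ring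
  have hminus : (1 - w) * (a + t) + w * (a - t) = a - s := by rw [hw]; field_simp; ring
  have h₁ := hf.2 hadd hsub hw0 hw1 (by ring)
  have h₂ := hf.2 hadd hsub hw1 hw0 (by ring)
  simp only [smul_eq_mul, hplus, hminus] at h₁ h₂
  linarith

/-- The even part of `t ↦ (1 + t) ^ p`, that is, the mean of `(1 ± t) ^ p`. -/
noncomputable def rpowEvenPart (p t : ℝ) : ℝ := ((1 + t) ^ p + (1 - t) ^ p) / 2

/-- The odd part of `t ↦ (1 + t) ^ p`; up to scalars, `rpowEvenPart` and `rpowOddPart` are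
exchanged by differentiation. -/
noncomputable def rpowOddPart (p t : ℝ) : ℝ := ((1 + t) ^ p - (1 - t) ^ p) / 2

section RpowParts

variable {p t : ℝ}

theorem hasDerivAt_one_add_rpow (ht : -1 < t) :
    HasDerivAt (fun s : ℝ => (1 + s) ^ p) (p * (1 + t) ^ (p - 1)) t := by
  simpa using ((hasDerivAt_id t).const_add 1).rpow_const (p := p)
    (Or.inl (by linarith : 0 < 1 + t).ne')

theorem hasDerivAt_one_sub_rpow (ht : t < 1) :
    HasDerivAt (fun s : ℝ => (1 - s) ^ p) (-(p * (1 - t) ^ (p - 1))) t := by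
  simpa using ((hasDerivAt_id t).const_sub 1).rpow_const (p := p) (Or.inl (sub_pos.2 ht).ne')

theorem hasDerivAt_rpowEvenPart (ht : t ∈ Set.Ioo (-1) 1) :
    HasDerivAt (rpowEvenPart p) (p * rpowOddPart (p - 1) t) t :=
  (((hasDerivAt_one_add_rpow ht.1).add (hasDerivAt_one_sub_rpow ht.2)).div_const 2).congr_deriv
    (by rw [rpowOddPart]; ring)

theorem hasDerivAt_rpowOddPart (ht : t ∈ Set.Ioo (-1) 1) :
    HasDerivAt (rpowOddPart p) (p * rpowEvenPart (p - 1) t) t :=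
  (((hasDerivAt_one_add_rpow ht.1).sub (hasDerivAt_one_sub_rpow ht.2)).div_const 2).congr_deriv
    (by rw [rpowEvenPart]; ring)

theorem continuous_rpowEvenPart (hp : 0 ≤ p) : Continuous (rpowEvenPart p) := by
  unfold rpowEvenPart
  fun_prop (disch := exact fun _ => Or.inr hp)

theorem continuous_rpowOddPart (hp : 0 ≤ p) : Continuous (rpowOddPart p) := by
  unfold rpowOddPart
  fun_prop (disch := exact fun _ => Or.inr hp)

theorem rpowEvenPart_zero (p : ℝ) : rpowEvenPart p 0 = 1 := by simp [rpowEvenPart]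

theorem rpowOddPart_zero (p : ℝ) : rpowOddPart p 0 = 0 := by simp [rpowOddPart]

theorem rpowEvenPart_pos (ht : t ∈ Set.Icc 0 1) : 0 < rpowEvenPart p t := by
  have hadd : 0 < (1 + t) ^ p := Real.rpow_pos_of_pos (by linarith [ht.1]) p
  have hsub : 0 ≤ (1 - t) ^ p := Real.rpow_nonneg (sub_nonneg.2 ht.2) p
  unfold rpowEvenPart
  positivity

theorem rpowEvenPart_monotoneOn (hp : 1 ≤ p) : MonotoneOn (rpowEvenPart p) (Set.Icc 0 1) := by
  intro s hs t ht hst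
  have := convexOn_add_sub_le (convexOn_rpow hp) (a := 1)
    ((abs_of_nonneg hs.1).trans_le hst) (Set.mem_Ici.2 (by linarith [ht.1]))
    (Set.mem_Ici.2 (sub_nonneg.2 ht.2))
  unfold rpowEvenPart
  linarith

theorem rpowEvenPart_sub_two_le (hp : 2 ≤ p) (ht : t ∈ Set.Icc 0 1) :
    rpowEvenPart (p - 2) t ≤ rpowEvenPart p t ^ (1 - 2 / p) := by
  have hexp : p * (1 - 2 / p) = p - 2 := by field_simp
  have hadd : 0 ≤ 1 + t := by linarith [ht.1]
  have hsub : 0 ≤ 1 - t := sub_nonneg.2 ht.2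
  have hconc := (Real.concaveOn_rpow (sub_nonneg.2 ((div_le_one (by linarith)).2 hp))
    (sub_le_self 1 (by positivity))).2 (Set.mem_Ici.2 (Real.rpow_nonneg hadd p))
    (Set.mem_Ici.2 (Real.rpow_nonneg hsub p)) one_half_pos.le one_half_pos.le (add_halves 1)
  simp only [smul_eq_mul, ← Real.rpow_mul hadd, ← Real.rpow_mul hsub, hexp] at hconc
  calc rpowEvenPart (p - 2) t = 1 / 2 * (1 + t) ^ (p - 2) + 1 / 2 * (1 - t) ^ (p - 2) := by
        rw [rpowEvenPart]; ring
    _ ≤ (1 / 2 * (1 + t) ^ p + 1 / 2 * (1 - t) ^ p) ^ (1 - 2 / p) := hconc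
    _ = rpowEvenPart p t ^ (1 - 2 / p) := by rw [rpowEvenPart]; congr 1; ring

theorem rpowOddPart_sub_one_le (hp : 2 ≤ p) (ht : t ∈ Set.Icc 0 1) :
    rpowOddPart (p - 1) t ≤ (p - 1) * rpowEvenPart p t ^ (1 - 2 / p) * t := by
  have hθ : 0 ≤ 1 - 2 / p := sub_nonneg.2 ((div_le_one (by linarith)).2 hp)
  refine image_le_of_deriv_right_le_deriv_boundary (a := 0) (b := t)
    (continuous_rpowOddPart (by linarith)).continuousOn
    (fun s hs => (hasDerivAt_rpowOddPart ⟨by linarith [hs.1], hs.2.trans_le ht.2⟩).hasDerivWithinAt)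
    (by simp [rpowOddPart_zero]) (by fun_prop)
    (fun s _ => ((hasDerivAt_id s).const_mul _).hasDerivWithinAt) (fun s hs => ?_) ⟨ht.1, le_rfl⟩
  have hs1 : s ∈ Set.Icc 0 1 := ⟨hs.1, hs.2.le.trans ht.2⟩
  calc (p - 1) * rpowEvenPart (p - 1 - 1) s = (p - 1) * rpowEvenPart (p - 2) s := by ring_nf
    _ ≤ (p - 1) * rpowEvenPart p s ^ (1 - 2 / p) := by
      gcongr
      exacts [by linarith, rpowEvenPart_sub_two_le hp hs1]
    _ ≤ (p - 1) * rpowEvenPart p t ^ (1 - 2 / p) * 1 := by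
      rw [mul_one]
      gcongr
      exacts [by linarith, (rpowEvenPart_pos hs1).le,
        rpowEvenPart_monotoneOn (by linarith) hs1 ht hs.2.le]

theorem rpowEvenPart_rpow_le (hp : 2 ≤ p) (ht : t ∈ Set.Icc 0 1) :
    rpowEvenPart p t ^ (2 / p) ≤ 1 + (p - 1) * t ^ 2 := by
  refine image_le_of_deriv_right_le_deriv_boundary (a := 0) (b := 1)
    (B := fun t => 1 + (p - 1) * t ^ 2) ((continuous_rpowEvenPart (by linarith)).rpow_const
      fun _ => Or.inr (by positivity)).continuousOn
    (fun s hs => ((hasDerivAt_rpowEvenPart ⟨by linarith [hs.1], hs.2⟩).rpow_const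
      (Or.inl (rpowEvenPart_pos ⟨hs.1, hs.2.le⟩).ne')).hasDerivWithinAt)
    (by simp [rpowEvenPart_zero]) (by fun_prop)
    (fun s _ => (((hasDerivAt_pow 2 s).const_mul _).const_add _).hasDerivWithinAt)
    (fun s hs => ?_) ht
  have hs1 : s ∈ Set.Icc 0 1 := ⟨hs.1, hs.2.le⟩
  have hE := rpowEvenPart_pos (p := p) hs1
  calc p * rpowOddPart (p - 1) s * (2 / p) * rpowEvenPart p s ^ (2 / p - 1)
      = 2 * rpowOddPart (p - 1) s * rpowEvenPart p s ^ (2 / p - 1) := by field_simp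
    _ ≤ 2 * ((p - 1) * rpowEvenPart p s ^ (1 - 2 / p) * s) * rpowEvenPart p s ^ (2 / p - 1) := by
      gcongr
      exact rpowOddPart_sub_one_le hp hs1
    _ = (p - 1) * (2 * s) * (rpowEvenPart p s ^ (1 - 2 / p) * rpowEvenPart p s ^ (2 / p - 1)) := by
      ring
    _ = (p - 1) * (2 * s) := by simp [← Real.rpow_add hE]
    _ = (p - 1) * (((2 : ℕ) : ℝ) * s ^ (2 - 1)) := by simp

end RpowParts

theorem add_rpow_add_sub_rpow_le {p a b : ℝ} (hp : 2 ≤ p) (hb : 0 ≤ b) (hba : b ≤ a) :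
    (a + b) ^ p + (a - b) ^ p ≤ 2 * (a ^ 2 + (p - 1) * b ^ 2) ^ (p / 2) := by
  obtain rfl | ha := (hb.trans hba).eq_or_lt
  · simpa [le_antisymm hba hb, Real.zero_rpow (by linarith : p ≠ 0)] using by positivity
  obtain ⟨t, ht, rfl⟩ : ∃ t ∈ Set.Icc 0 1, b = a * t :=
    ⟨b / a, ⟨by positivity, (div_le_one ha).2 hba⟩, (mul_div_cancel₀ b ha.ne').symm⟩
  have hp1 : 0 ≤ p - 1 := by linarith
  have key : rpowEvenPart p t ≤ (1 + (p - 1) * t ^ 2) ^ (p / 2) := by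
    rw [← Real.rpow_inv_le_iff_of_pos (rpowEvenPart_pos ht).le (by positivity) (by linarith),
      inv_div]
    exact rpowEvenPart_rpow_le hp ht
  calc (a + a * t) ^ p + (a - a * t) ^ p = 2 * (a ^ p * rpowEvenPart p t) := by
        rw [← mul_one_add, ← mul_one_sub, Real.mul_rpow ha.le (by linarith [ht.1]),
          Real.mul_rpow ha.le (by linarith [ht.2]), rpowEvenPart]
        ring
    _ ≤ 2 * (a ^ p * (1 + (p - 1) * t ^ 2) ^ (p / 2)) := by gcongr
    _ = 2 * (a ^ 2 + (p - 1) * (a * t) ^ 2) ^ (p / 2) := by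
      rw [← sq_rpow_half ha.le, ← Real.mul_rpow (by positivity) (by positivity)]
      ring_nf

theorem add_rpow_add_abs_sub_rpow_le {p a b : ℝ} (hp : 2 ≤ p) (ha : 0 ≤ a) (hb : 0 ≤ b) :
    (a + b) ^ p + |a - b| ^ p ≤ 2 * (a ^ 2 + (p - 1) * b ^ 2) ^ (p / 2) := by
  obtain hba | hab := le_total b a
  · rw [abs_of_nonneg (sub_nonneg.2 hba)]
    exact add_rpow_add_sub_rpow_le hp hb hba
  · have hsq : a ^ 2 ≤ b ^ 2 := by gcongr
    have hp1 : 0 ≤ p - 1 := by linarith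
    rw [abs_sub_comm, abs_of_nonneg (sub_nonneg.2 hab), add_comm a]
    refine (add_rpow_add_sub_rpow_le hp ha hab).trans ?_
    gcongr 2 * ?_ ^ (p / 2)
    nlinarith

/-- The two-point form of 2-uniform smoothness of `E` with exponent `p` and constant `K`: the `L^p`
mean of `‖x ± y‖` is at most `(‖x‖² + K ‖y‖²) ^ (1 / 2)`. It passes from `E` to `L^q(μ; E)` for
`2 ≤ q ≤ p`. -/
def TwoPointSmooth (p K : ℝ) (E : Type*) [NormedAddCommGroup E] : Prop :=
  ∀ x y : E, ‖x + y‖ ^ p + ‖x - y‖ ^ p ≤ 2 * (‖x‖ ^ 2 + K * ‖y‖ ^ 2) ^ (p / 2)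

theorem twoPointSmooth_of_innerProductSpace {H : Type*} [NormedAddCommGroup H]
    [InnerProductSpace ℝ H] {p : ℝ} (hp : 2 ≤ p) : TwoPointSmooth p (p - 1) H := by
  intro x y
  have hinner : |2 * inner ℝ x y| ≤ 2 * (‖x‖ * ‖y‖) := by
    rw [abs_mul, abs_two]
    gcongr
    exact abs_real_inner_le_norm x y
  have hadd : ‖x‖ ^ 2 + ‖y‖ ^ 2 + 2 * (‖x‖ * ‖y‖) = (‖x‖ + ‖y‖) ^ 2 := by ring
  have hsub : ‖x‖ ^ 2 + ‖y‖ ^ 2 - 2 * (‖x‖ * ‖y‖) = |‖x‖ - ‖y‖| ^ 2 := by rw [sq_abs]; ring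
  calc ‖x + y‖ ^ p + ‖x - y‖ ^ p
      = (‖x‖ ^ 2 + ‖y‖ ^ 2 + 2 * inner ℝ x y) ^ (p / 2) +
          (‖x‖ ^ 2 + ‖y‖ ^ 2 - 2 * inner ℝ x y) ^ (p / 2) := by
        rw [← sq_rpow_half (norm_nonneg _), ← sq_rpow_half (norm_nonneg (x - y)),
          norm_add_sq_real, norm_sub_sq_real]
        ring_nf
    _ ≤ (‖x‖ ^ 2 + ‖y‖ ^ 2 + 2 * (‖x‖ * ‖y‖)) ^ (p / 2) +
          (‖x‖ ^ 2 + ‖y‖ ^ 2 - 2 * (‖x‖ * ‖y‖)) ^ (p / 2) :=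
        convexOn_add_sub_le (convexOn_rpow (by linarith)) hinner
          (Set.mem_Ici.2 (by positivity)) (Set.mem_Ici.2 (hsub ▸ sq_nonneg _))
    _ = (‖x‖ + ‖y‖) ^ p + |‖x‖ - ‖y‖| ^ p := by
        rw [hadd, hsub, sq_rpow_half (by positivity), sq_rpow_half (by positivity)]
    _ ≤ 2 * (‖x‖ ^ 2 + (p - 1) * ‖y‖ ^ 2) ^ (p / 2) :=
        add_rpow_add_abs_sub_rpow_le hp (norm_nonneg x) (norm_nonneg y)

section BirkhoffOrthogonal

variable {E : Type*} [NormedAddCommGroup E] {p K : ℝ}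

theorem TwoPointSmooth.sq_add_sq_le (hE : TwoPointSmooth p K E) (hp : 2 ≤ p) (hK : 0 ≤ K)
    (x y : E) : ‖x + y‖ ^ 2 + ‖x - y‖ ^ 2 ≤ 2 * (‖x‖ ^ 2 + K * ‖y‖ ^ 2) := by
  have hmean := (convexOn_rpow (by linarith : 1 ≤ p / 2)).2 (Set.mem_Ici.2 (sq_nonneg ‖x + y‖))
    (Set.mem_Ici.2 (sq_nonneg ‖x - y‖)) one_half_pos.le one_half_pos.le (add_halves 1)
  simp only [smul_eq_mul, sq_rpow_half (norm_nonneg _)] at hmean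
  have := (Real.rpow_le_rpow_iff (by positivity) (by positivity)
    (by linarith : 0 < p / 2)).1 (hmean.trans (by linarith [hE x y] :
      _ ≤ (‖x‖ ^ 2 + K * ‖y‖ ^ 2) ^ (p / 2)))
  linarith

/-- Birkhoff orthogonality of `x` to `y`: no multiple of `y` added to `x` decreases its norm. -/
def BirkhoffOrthogonal [NormedSpace ℝ E] (x y : E) : Prop := ∀ t : ℝ, ‖x‖ ≤ ‖x + t • y‖

variable [NormedSpace ℝ E]

theorem BirkhoffOrthogonal.smul_right {x y : E} (h : BirkhoffOrthogonal x y) (c : ℝ) :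
    BirkhoffOrthogonal x (c • y) := fun t => by
  simpa only [smul_smul] using h (t * c)

-- Smoothness at `x` gives the case `n = 0`; smoothness at `x + y / 2` halves the excess `2⁻ⁿ`.
theorem TwoPointSmooth.sq_norm_add_le_one_add_half_pow (hE : TwoPointSmooth p K E) (hp : 2 ≤ p)
    (hK : 0 ≤ K) {x : E} (n : ℕ) : ∀ {y : E}, BirkhoffOrthogonal x y →
      ‖x + y‖ ^ 2 ≤ ‖x‖ ^ 2 + K * ‖y‖ ^ 2 * (1 + (1 / 2) ^ n) := by
  induction n with
  | zero =>
    intro y hxy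
    have hsub : ‖x‖ ^ 2 ≤ ‖x - y‖ ^ 2 := by
      gcongr
      simpa [← sub_eq_add_neg] using hxy (-1)
    linarith [hE.sq_add_sq_le hp hK x y]
  | succ n ih =>
    intro y hxy
    set z := (1 / 2 : ℝ) • y with hz
    have hzz : x + z + z = x + y := by rw [hz]; module
    have hnorm : ‖z‖ ^ 2 = ‖y‖ ^ 2 / 4 := by
      rw [hz, norm_smul, mul_pow]; norm_num; ring
    have hsmooth := hE.sq_add_sq_le hp hK (x + z) z
    have hhalf := ih (hxy.smul_right (1 / 2))
    rw [hzz, add_sub_cancel_right, hnorm] at hsmooth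
    rw [← hz, hnorm] at hhalf
    rw [pow_succ _ n]
    linarith

theorem TwoPointSmooth.sq_norm_add_le_of_birkhoffOrthogonal (hE : TwoPointSmooth p K E)
    (hp : 2 ≤ p) (hK : 0 ≤ K) {x y : E} (hxy : BirkhoffOrthogonal x y) :
    ‖x + y‖ ^ 2 ≤ ‖x‖ ^ 2 + K * ‖y‖ ^ 2 := by
  have hlim : Filter.Tendsto (fun n : ℕ => ‖x‖ ^ 2 + K * ‖y‖ ^ 2 * (1 + (1 / 2 : ℝ) ^ n))
      Filter.atTop (nhds (‖x‖ ^ 2 + K * ‖y‖ ^ 2 * (1 + 0))) :=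
    (((tendsto_pow_atTop_nhds_zero_of_lt_one (by norm_num) (by norm_num)).const_add 1).const_mul
      _).const_add _
  rw [add_zero, mul_one] at hlim
  exact ge_of_tendsto' hlim fun n => hE.sq_norm_add_le_one_add_half_pow hp hK n hxy

end BirkhoffOrthogonal

section LpNorm

variable {α F G : Type*} {mα : MeasurableSpace α} {μ : Measure α} [NormedAddCommGroup F]
  [NormedAddCommGroup G] {f : α → F}

theorem lpNorm_rpow_eq_integral {p : ℝ} (hp : 0 < p) (hf : AEStronglyMeasurable f μ) :
    lpNorm f (ENNReal.ofReal p) μ ^ p = ∫ x, ‖f x‖ ^ p ∂μ := by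
  rw [lpNorm_eq_integral_norm_rpow_toReal (by simpa using hp) ENNReal.ofReal_ne_top hf,
    ENNReal.toReal_ofReal hp.le, Real.rpow_inv_rpow (integral_nonneg fun _ => by positivity) hp.ne']

theorem integrable_norm_rpow_of_memLp {p : ℝ} (hp : 0 < p) (hf : MemLp f (ENNReal.ofReal p) μ) :
    Integrable (fun x => ‖f x‖ ^ p) μ := by
  simpa only [ENNReal.toReal_ofReal hp.le] using
    hf.integrable_norm_rpow (by simpa using hp) ENNReal.ofReal_ne_top

theorem Lp_norm_eq_lpNorm {p : ENNReal} (u : Lp F p μ) : ‖u‖ = lpNorm u p μ := by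
  rw [Lp.norm_def, toReal_eLpNorm (Lp.aestronglyMeasurable u)]

theorem norm_toLp_eq_lpNorm {p : ENNReal} (hf : MemLp f p μ) : ‖hf.toLp f‖ = lpNorm f p μ := by
  rw [Lp.norm_toLp, toReal_eLpNorm hf.1]

theorem memLp_norm_sq {q : ℝ} (hf : MemLp f (ENNReal.ofReal q) μ) :
    MemLp (fun x => ‖f x‖ ^ 2) (ENNReal.ofReal (q / 2)) μ := by
  simpa [ENNReal.ofReal_div_of_pos] using hf.norm_rpow_div 2

theorem lpNorm_norm_sq {q : ℝ} (hq : 0 < q) (hf : AEStronglyMeasurable f μ) :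
    lpNorm (fun x => ‖f x‖ ^ 2) (ENNReal.ofReal (q / 2)) μ =
      lpNorm f (ENNReal.ofReal q) μ ^ 2 := by
  rw [← Real.rpow_left_inj lpNorm_nonneg (by positivity) (half_pos hq).ne',
    sq_rpow_half lpNorm_nonneg, lpNorm_rpow_eq_integral hq hf,
    lpNorm_rpow_eq_integral (f := fun x => ‖f x‖ ^ 2) (half_pos hq) (hf.norm.pow 2)]
  simp only [norm_pow, norm_norm, sq_rpow_half (norm_nonneg _)]

theorem memLp_sq_add_mul_sq {g : α → G} {q : ℝ} (K : ℝ) (hf : MemLp f (ENNReal.ofReal q) μ)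
    (hg : MemLp g (ENNReal.ofReal q) μ) :
    MemLp (fun x => ‖f x‖ ^ 2 + K * ‖g x‖ ^ 2) (ENNReal.ofReal (q / 2)) μ :=
  (memLp_norm_sq hf).add ((memLp_norm_sq hg).const_mul K)

theorem integrable_sq_add_mul_sq_rpow {g : α → G} {q K : ℝ} (hq : 0 < q) (hK : 0 ≤ K)
    (hf : MemLp f (ENNReal.ofReal q) μ) (hg : MemLp g (ENNReal.ofReal q) μ) :
    Integrable (fun x => (‖f x‖ ^ 2 + K * ‖g x‖ ^ 2) ^ (q / 2)) μ := by
  simpa only [Real.norm_of_nonneg (by positivity : 0 ≤ ‖f _‖ ^ 2 + K * ‖g _‖ ^ 2)] using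
    integrable_norm_rpow_of_memLp (half_pos hq) (memLp_sq_add_mul_sq K hf hg)

theorem integral_sq_add_mul_sq_rpow_le {g : α → G} {q K : ℝ} (hq : 2 ≤ q) (hK : 0 ≤ K)
    (hf : MemLp f (ENNReal.ofReal q) μ) (hg : MemLp g (ENNReal.ofReal q) μ) :
    ∫ x, (‖f x‖ ^ 2 + K * ‖g x‖ ^ 2) ^ (q / 2) ∂μ ≤
      (lpNorm f (ENNReal.ofReal q) μ ^ 2 + K * lpNorm g (ENNReal.ofReal q) μ ^ 2) ^ (q / 2) := by
  have hq0 : 0 < q := by linarith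
  have hint := lpNorm_rpow_eq_integral (half_pos hq0) (memLp_sq_add_mul_sq K hf hg).1
  simp only [Real.norm_of_nonneg (by positivity : 0 ≤ ‖f _‖ ^ 2 + K * ‖g _‖ ^ 2)] at hint
  rw [← hint]
  gcongr
  · exact lpNorm_nonneg
  calc lpNorm (fun x => ‖f x‖ ^ 2 + K * ‖g x‖ ^ 2) (ENNReal.ofReal (q / 2)) μ
      ≤ lpNorm (fun x => ‖f x‖ ^ 2) (ENNReal.ofReal (q / 2)) μ +
          lpNorm (K • fun x => ‖g x‖ ^ 2) (ENNReal.ofReal (q / 2)) μ :=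
        lpNorm_add_le (memLp_norm_sq hf) (by simpa using (by linarith : 1 ≤ q / 2))
    _ = lpNorm f (ENNReal.ofReal q) μ ^ 2 + K * lpNorm g (ENNReal.ofReal q) μ ^ 2 := by
        rw [lpNorm_const_smul, lpNorm_norm_sq hq0 hf.1, lpNorm_norm_sq hq0 hg.1, coe_nnnorm,
          Real.norm_of_nonneg hK]

theorem rpow_integral_add_rpow_integral_le {f g : α → ℝ} {r : ℝ} (hr : 1 ≤ r) (hf0 : 0 ≤ f)
    (hg0 : 0 ≤ g) (hf : Integrable f μ) (hg : Integrable g μ) :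
    (∫ x, f x ∂μ) ^ r + (∫ x, g x ∂μ) ^ r ≤ (∫ x, (f x ^ r + g x ^ r) ^ r⁻¹ ∂μ) ^ r := by
  have hr0 : 0 < r := by linarith
  have : Fact (1 ≤ ENNReal.ofReal r) := ⟨by simpa using hr⟩
  have htr : (ENNReal.ofReal r).toReal = r := ENNReal.toReal_ofReal hr0.le
  let e := (WithLp.prodContinuousLinearEquiv (ENNReal.ofReal r) ℝ ℝ ℝ).symm
  have hnorm {x y : ℝ} (hx : 0 ≤ x) (hy : 0 ≤ y) : ‖e (x, y)‖ = (x ^ r + y ^ r) ^ r⁻¹ := by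
    rw [WithLp.prod_norm_eq_add (by rwa [htr]), htr, one_div]
    simp [e, abs_of_nonneg hx, abs_of_nonneg hy]
  have hf_int : 0 ≤ ∫ x, f x ∂μ := integral_nonneg hf0
  have hg_int : 0 ≤ ∫ x, g x ∂μ := integral_nonneg hg0
  have hintegral : ∫ x, e (f x, g x) ∂μ = e (∫ x, f x ∂μ, ∫ x, g x ∂μ) := by
    rw [← integral_pair hf hg]
    exact e.integral_comp_comm _
  rw [← Real.rpow_inv_le_iff_of_pos (by positivity)
    (integral_nonneg fun x => Real.rpow_nonneg (add_nonneg (Real.rpow_nonneg (hf0 x) r)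
      (Real.rpow_nonneg (hg0 x) r)) _) hr0]
  -- This is the triangle inequality for the integral of `(f, g)` in `ℝ²` with the `ℓ^r` norm.
  calc ((∫ x, f x ∂μ) ^ r + (∫ x, g x ∂μ) ^ r) ^ r⁻¹
      = ‖∫ x, e (f x, g x) ∂μ‖ := by rw [hintegral, hnorm hf_int hg_int]
    _ ≤ ∫ x, ‖e (f x, g x)‖ ∂μ := norm_integral_le_integral_norm _
    _ = ∫ x, (f x ^ r + g x ^ r) ^ r⁻¹ ∂μ := by simp only [hnorm (hf0 _) (hg0 _)]

end LpNorm

theorem TwoPointSmooth.rpow_inv_le {F : Type*} [NormedAddCommGroup F] {q r K : ℝ}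
    (hF : TwoPointSmooth (q * r) K F) (hr : 0 < r) (hK : 0 ≤ K) (x y : F) :
    ((‖x + y‖ ^ q) ^ r + (‖x - y‖ ^ q) ^ r) ^ r⁻¹ ≤
      2 ^ r⁻¹ * (‖x‖ ^ 2 + K * ‖y‖ ^ 2) ^ (q / 2) := by
  rw [← Real.rpow_mul (norm_nonneg _), ← Real.rpow_mul (norm_nonneg _),
    Real.rpow_inv_le_iff_of_pos (by positivity) (by positivity) hr,
    Real.mul_rpow (by positivity) (by positivity), Real.rpow_inv_rpow two_pos.le hr.ne',
    ← Real.rpow_mul (by positivity), div_mul_eq_mul_div]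
  exact hF x y

theorem TwoPointSmooth.lp {α F : Type*} {mα : MeasurableSpace α} (μ : Measure α)
    [NormedAddCommGroup F] {p q K : ℝ} [hq : Fact (2 ≤ q)] (hF : TwoPointSmooth p K F)
    (hqp : q ≤ p) (hK : 0 ≤ K) : TwoPointSmooth p K (Lp F (ENNReal.ofReal q) μ) := by
  intro u v
  have hq := hq.out
  have hq0 : 0 < q := by linarith
  obtain ⟨r, hr, rfl⟩ : ∃ r, 1 ≤ r ∧ p = q * r :=
    ⟨p / q, (one_le_div hq0).2 hqp, (mul_div_cancel₀ p hq0.ne').symm⟩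
  have hr0 : 0 < r := by linarith
  have hpow (w : Lp F (ENNReal.ofReal q) μ) : ‖w‖ ^ (q * r) = (∫ x, ‖w x‖ ^ q ∂μ) ^ r := by
    rw [Real.rpow_mul (norm_nonneg w), Lp_norm_eq_lpNorm,
      lpNorm_rpow_eq_integral hq0 (Lp.aestronglyMeasurable w)]
  have hpointwise : ∀ᵐ x ∂μ, ((‖(u + v) x‖ ^ q) ^ r + (‖(u - v) x‖ ^ q) ^ r) ^ r⁻¹ ≤
      2 ^ r⁻¹ * (‖u x‖ ^ 2 + K * ‖v x‖ ^ 2) ^ (q / 2) := by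
    filter_upwards [Lp.coeFn_add u v, Lp.coeFn_sub u v] with x hadd hsub
    rw [hadd, hsub]
    exact hF.rpow_inv_le hr0 hK (u x) (v x)
  calc ‖u + v‖ ^ (q * r) + ‖u - v‖ ^ (q * r)
      = (∫ x, ‖(u + v) x‖ ^ q ∂μ) ^ r + (∫ x, ‖(u - v) x‖ ^ q ∂μ) ^ r := by rw [hpow, hpow]
    _ ≤ (∫ x, ((‖(u + v) x‖ ^ q) ^ r + (‖(u - v) x‖ ^ q) ^ r) ^ r⁻¹ ∂μ) ^ r :=
        rpow_integral_add_rpow_integral_le hr (fun _ => by positivity) (fun _ => by positivity)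
          (integrable_norm_rpow_of_memLp hq0 (Lp.memLp _))
          (integrable_norm_rpow_of_memLp hq0 (Lp.memLp _))
    _ ≤ (2 ^ r⁻¹ * ∫ x, (‖u x‖ ^ 2 + K * ‖v x‖ ^ 2) ^ (q / 2) ∂μ) ^ r := by
        rw [← integral_const_mul]
        exact Real.rpow_le_rpow (integral_nonneg fun _ => by positivity)
          (integral_mono_of_nonneg (.of_forall fun _ => by positivity)
            ((integrable_sq_add_mul_sq_rpow hq0 hK (Lp.memLp u) (Lp.memLp v)).const_mul _)
            hpointwise) hr0.le
    _ = 2 * (∫ x, (‖u x‖ ^ 2 + K * ‖v x‖ ^ 2) ^ (q / 2) ∂μ) ^ r := by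
        rw [Real.mul_rpow (by positivity) (integral_nonneg fun _ => by positivity),
          Real.rpow_inv_rpow two_pos.le hr0.ne']
    _ ≤ 2 * ((‖u‖ ^ 2 + K * ‖v‖ ^ 2) ^ (q / 2)) ^ r := by
        rw [Lp_norm_eq_lpNorm, Lp_norm_eq_lpNorm]
        gcongr
        exact integral_sq_add_mul_sq_rpow_le hq hK (Lp.memLp u) (Lp.memLp v)
    _ = 2 * (‖u‖ ^ 2 + K * ‖v‖ ^ 2) ^ (q * r / 2) := by
        rw [← Real.rpow_mul (by positivity), div_mul_eq_mul_div]

section Martingale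

variable {Ω E : Type*} {mΩ : MeasurableSpace Ω} {P : Measure Ω} {ℱ : Filtration ℕ mΩ}

theorem mul_measureReal_le_sup'_le_integral [IsFiniteMeasure P] {f : ℕ → Ω → ℝ}
    (hf : Submartingale f ℱ P) (hf0 : 0 ≤ f) {ε : ℝ} (hε : 0 ≤ ε) (n : ℕ) :
    ε * P.real {ω | ε ≤ (Finset.range (n + 1)).sup' Finset.nonempty_range_add_one
      fun k => f k ω} ≤ ∫ ω, f n ω ∂P := by
  lift ε to NNReal using hε
  have hfn : 0 ≤ ∫ ω, f n ω ∂P := integral_nonneg (hf0 n)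
  have hdoob := (maximal_ineq hf hf0 (ε := ε) n).trans (ENNReal.ofReal_le_ofReal
    (setIntegral_le_integral (hf.integrable n) (.of_forall (hf0 n))))
  simpa [Measure.real, ENNReal.toReal_mul, hfn] using
    ENNReal.toReal_mono ENNReal.ofReal_ne_top hdoob

variable [NormedAddCommGroup E]

theorem lpNorm_le_of_ae_bound [IsProbabilityMeasure P] {f : Ω → E} {b : ℝ} (hb : 0 ≤ b)
    (hf : ∀ᵐ ω ∂P, ‖f ω‖ ≤ b) (p : ENNReal) : lpNorm f p P ≤ b := by
  by_cases hfm : AEStronglyMeasurable f P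
  · rw [← toReal_eLpNorm hfm]
    exact ENNReal.toReal_le_of_le_ofReal hb (by simpa using eLpNorm_le_of_ae_bound (p := p) hf)
  · rwa [lpNorm_of_not_aestronglyMeasurable hfm]

theorem memLp_partialSum {d : ℕ → Ω → E} {p : ENNReal} (hd : ∀ i, 1 ≤ i → MemLp (d i) p P)
    (k : ℕ) : MemLp (partialSum d k) p P :=
  memLp_finsetSum _ fun i hi => hd i (Finset.mem_Icc.1 hi).1

variable [NormedSpace ℝ E] [CompleteSpace E]

theorem condExp_add_of_condExp_eq_zero [IsFiniteMeasure P] {m : MeasurableSpace Ω} (hm : m ≤ mΩ)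
    {X D : Ω → E} (hXm : StronglyMeasurable[m] X) (hX : Integrable X P) (hD : Integrable D P)
    (hD0 : P[D | m] =ᵐ[P] 0) : P[X + D | m] =ᵐ[P] X := by
  filter_upwards [condExp_add hX hD m, hD0] with ω hadd hzero
  rw [hadd, Pi.add_apply, hzero, condExp_of_stronglyMeasurable hm hXm hX, Pi.zero_apply, add_zero]

theorem birkhoffOrthogonal_toLp_of_condExp_eq_zero [IsFiniteMeasure P] {p : ENNReal}
    [hp : Fact (1 ≤ p)] {m : MeasurableSpace Ω} (hm : m ≤ mΩ) {X D : Ω → E}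
    (hXm : StronglyMeasurable[m] X) (hX : MemLp X p P) (hD : MemLp D p P)
    (hD0 : P[D | m] =ᵐ[P] 0) : BirkhoffOrthogonal (hX.toLp X) (hD.toLp D) := by
  intro t
  have hcond : P[X + t • D | m] =ᵐ[P] X := by
    refine condExp_add_of_condExp_eq_zero hm hXm (hX.integrable hp.out)
      ((hD.integrable hp.out).smul t) ((condExp_smul t D m).trans ?_)
    filter_upwards [hD0] with ω hω
    simp [hω]
  rw [← MemLp.toLp_const_smul, ← MemLp.toLp_add, Lp.norm_toLp, Lp.norm_toLp,
    ← eLpNorm_congr_ae hcond]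
  exact ENNReal.toReal_mono (hX.add (hD.const_smul t)).eLpNorm_ne_top
    (eLpNorm_condExp_le_eLpNorm _ hp.out)

theorem TwoPointSmooth.sq_lpNorm_add_le [IsFiniteMeasure P] {p K : ℝ}
    (hE : TwoPointSmooth p K E) (hp : 2 ≤ p) (hK : 0 ≤ K) {m : MeasurableSpace Ω} (hm : m ≤ mΩ)
    {X D : Ω → E} (hXm : StronglyMeasurable[m] X) (hX : MemLp X (ENNReal.ofReal p) P)
    (hD : MemLp D (ENNReal.ofReal p) P) (hD0 : P[D | m] =ᵐ[P] 0) :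
    lpNorm (X + D) (ENNReal.ofReal p) P ^ 2 ≤
      lpNorm X (ENNReal.ofReal p) P ^ 2 + K * lpNorm D (ENNReal.ofReal p) P ^ 2 := by
  have : Fact (2 ≤ p) := ⟨hp⟩
  simpa only [← MemLp.toLp_add, norm_toLp_eq_lpNorm] using
    (hE.lp P le_rfl hK).sq_norm_add_le_of_birkhoffOrthogonal hp hK
      (birkhoffOrthogonal_toLp_of_condExp_eq_zero hm hXm hX hD hD0)

theorem partialSum_zero {G : Type*} [AddCommMonoid G] (d : ℕ → Ω → G) : partialSum d 0 = 0 := by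
  ext ω
  simp [partialSum]

theorem partialSum_succ {G : Type*} [AddCommMonoid G] (d : ℕ → Ω → G) (k : ℕ) :
    partialSum d (k + 1) = partialSum d k + d (k + 1) := by
  ext ω
  simp [partialSum, Finset.sum_Icc_succ_top]

namespace IsMartingaleDifference

variable {d : ℕ → Ω → E} {p : ℝ}

theorem stronglyMeasurable_partialSum (hd : IsMartingaleDifference d ℱ P) (k : ℕ) :
    StronglyMeasurable[ℱ k] (partialSum d k) :=
  Finset.stronglyMeasurable_fun_sum _ fun i hi =>
    (hd.stronglyMeasurable i (Finset.mem_Icc.1 hi).1).mono (ℱ.mono (Finset.mem_Icc.1 hi).2)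

variable [IsFiniteMeasure P]

theorem condExp_partialSum_succ (hd : IsMartingaleDifference d ℱ P) {k : ℕ} (hk : 1 ≤ k) :
    P[partialSum d (k + 1) | ℱ k] =ᵐ[P] partialSum d k := by
  have hint : Integrable (partialSum d k) P :=
    integrable_finsetSum _ fun i hi => hd.integrable i (Finset.mem_Icc.1 hi).1
  rw [partialSum_succ]
  exact condExp_add_of_condExp_eq_zero (ℱ.le k) (hd.stronglyMeasurable_partialSum k) hint
    (hd.integrable _ k.succ_pos) (hd.condExp_eq_zero k hk)

theorem sq_lpNorm_partialSum_le (hd : IsMartingaleDifference d ℱ P) {K : ℝ}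
    (hE : TwoPointSmooth p K E) (hp : 2 ≤ p) (hK : 1 ≤ K)
    (hdp : ∀ i, 1 ≤ i → MemLp (d i) (ENNReal.ofReal p) P) (n : ℕ) :
    lpNorm (partialSum d n) (ENNReal.ofReal p) P ^ 2 ≤
      K * ∑ i ∈ Finset.Icc 1 n, lpNorm (d i) (ENNReal.ofReal p) P ^ 2 := by
  induction n with
  | zero => simp [partialSum_zero]
  | succ n ih =>
    rw [partialSum_succ, Finset.sum_Icc_succ_top n.succ_pos, mul_add]
    obtain rfl | hn := n.eq_zero_or_pos
    · simpa [partialSum_zero] using le_mul_of_one_le_left (sq_nonneg _) hK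
    · linarith [hE.sq_lpNorm_add_le hp (by linarith) (ℱ.le n) (hd.stronglyMeasurable_partialSum n)
        (memLp_partialSum hdp n) (hdp _ n.succ_pos) (hd.condExp_eq_zero n hn)]

theorem submartingale_norm_partialSum_rpow (hd : IsMartingaleDifference d ℱ P) (hp : 1 ≤ p)
    (hdp : ∀ i, 1 ≤ i → MemLp (d i) (ENNReal.ofReal p) P) :
    Submartingale (fun k ω => ‖partialSum d k ω‖ ^ p) ℱ P := by
  have hp0 : 0 < p := by linarith
  have hint (k : ℕ) : Integrable (fun ω => ‖partialSum d k ω‖ ^ p) P :=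
    integrable_norm_rpow_of_memLp hp0 (memLp_partialSum hdp k)
  refine submartingale_nat (fun k => (Real.continuous_rpow_const hp0.le).comp_stronglyMeasurable
    (hd.stronglyMeasurable_partialSum k).norm) hint fun k => ?_
  obtain rfl | hk := k.eq_zero_or_pos
  · have hzero : (fun ω => ‖partialSum d 0 ω‖ ^ p) = 0 := by
      ext ω
      simp [partialSum_zero, Real.zero_rpow hp0.ne']
    rw [hzero]
    exact condExp_nonneg (.of_forall fun ω => Real.rpow_nonneg (norm_nonneg _) p)
  · filter_upwards [Integrable.norm_condExp_rpow_le (m := ℱ k) hp (hint (k + 1)),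
      hd.condExp_partialSum_succ hk] with ω hjensen hmartingale
    rwa [hmartingale] at hjensen

theorem measureReal_le_sup'_norm_partialSum_le (hd : IsMartingaleDifference d ℱ P) (hp : 1 ≤ p)
    (hdp : ∀ i, 1 ≤ i → MemLp (d i) (ENNReal.ofReal p) P) {n : ℕ} (hn : 1 ≤ n) {x : ℝ}
    (hx : 0 < x) :
    P.real {ω | x ≤ (Finset.Icc 1 n).sup' (Finset.nonempty_Icc.mpr hn)
      (fun k => ‖partialSum d k ω‖)} ≤
      lpNorm (partialSum d n) (ENNReal.ofReal p) P ^ p / x ^ p := by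
  have hp0 : 0 < p := by linarith
  have hxp : 0 < x ^ p := Real.rpow_pos_of_pos hx p
  have hsub : {ω | x ≤ (Finset.Icc 1 n).sup' (Finset.nonempty_Icc.mpr hn)
      (fun k => ‖partialSum d k ω‖)} ⊆ {ω | x ^ p ≤ (Finset.range (n + 1)).sup'
        Finset.nonempty_range_add_one fun k => ‖partialSum d k ω‖ ^ p} := by
    intro ω hω
    simp only [Set.mem_ofPred_eq, Finset.le_sup'_iff] at hω ⊢
    obtain ⟨k, hk, hxk⟩ := hω
    exact ⟨k, Finset.mem_range_succ_iff.2 (Finset.mem_Icc.1 hk).2, by gcongr⟩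
  rw [le_div_iff₀' hxp, lpNorm_rpow_eq_integral hp0 (memLp_partialSum hdp n).1]
  exact (mul_le_mul_of_nonneg_left (measureReal_mono hsub) hxp.le).trans
    (mul_measureReal_le_sup'_le_integral (hd.submartingale_norm_partialSum_rpow hp hdp)
      (fun k ω => Real.rpow_nonneg (norm_nonneg _) p) hxp.le n)

end IsMartingaleDifference

theorem IsMartingaleDifference.measureReal_le_sup'_norm_partialSum_le_of_bound
    [IsProbabilityMeasure P] {d : ℕ → Ω → E} {p K b : ℝ} (hd : IsMartingaleDifference d ℱ P)
    (hE : TwoPointSmooth p K E) (hp : 2 ≤ p) (hK : 1 ≤ K) (hb : 0 ≤ b)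
    (hdb : ∀ i, 1 ≤ i → ∀ᵐ ω ∂P, ‖d i ω‖ ≤ b) {n : ℕ} (hn : 1 ≤ n) {x : ℝ} (hx : 0 < x) :
    P.real {ω | x ≤ (Finset.Icc 1 n).sup' (Finset.nonempty_Icc.mpr hn)
      (fun k => ‖partialSum d k ω‖)} ≤ (b ^ 2 * K * n) ^ (p / 2) / x ^ p := by
  have hdp (i : ℕ) (hi : 1 ≤ i) : MemLp (d i) (ENNReal.ofReal p) P :=
    .of_bound (hd.integrable i hi).1 b (hdb i hi)
  have hsum : ∑ i ∈ Finset.Icc 1 n, lpNorm (d i) (ENNReal.ofReal p) P ^ 2 ≤ n * b ^ 2 := by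
    simpa using Finset.sum_le_card_nsmul (Finset.Icc 1 n) _ (b ^ 2) fun i hi =>
      pow_le_pow_left₀ lpNorm_nonneg
        (lpNorm_le_of_ae_bound hb (hdb i (Finset.mem_Icc.1 hi).1) _) 2
  have hsq : lpNorm (partialSum d n) (ENNReal.ofReal p) P ^ 2 ≤ b ^ 2 * K * n :=
    calc lpNorm (partialSum d n) (ENNReal.ofReal p) P ^ 2
        ≤ K * ∑ i ∈ Finset.Icc 1 n, lpNorm (d i) (ENNReal.ofReal p) P ^ 2 :=
          hd.sq_lpNorm_partialSum_le hE hp hK hdp n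
      _ ≤ K * (n * b ^ 2) := by gcongr
      _ = b ^ 2 * K * n := by ring
  refine (hd.measureReal_le_sup'_norm_partialSum_le (by linarith) hdp hn hx).trans ?_
  rw [← sq_rpow_half lpNorm_nonneg p]
  gcongr

end Martingale

section Bounds

variable {q b x u : ℝ} {n : ℕ}

theorem mul_sqrt_le_iff {c : ℝ} (hb : 0 ≤ b) (hc : 0 ≤ c) (hx : 0 ≤ x) :
    b * √c ≤ x ↔ b ^ 2 * c ≤ x ^ 2 := by
  rw [← pow_le_pow_iff_left₀ (by positivity) hx two_ne_zero, mul_pow, Real.sq_sqrt hc]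

theorem sq_div_rpow_half_div_rpow (hx : 0 < x) (hu : 0 ≤ u) (p : ℝ) :
    (x ^ 2 / u) ^ (p / 2) / x ^ p = u ^ (-(p / 2)) := by
  rw [Real.div_rpow (sq_nonneg x) hu, sq_rpow_half hx.le, Real.rpow_neg hu]
  field_simp

theorem one_div_sqrt_exp_one_mul_exp_neg (y : ℝ) :
    1 / √(Real.exp 1) * Real.exp (-y) = Real.exp (-(1 / 2 + y)) := by
  rw [← Real.exp_half, one_div, ← Real.exp_neg, ← Real.exp_add]
  ring_nf

theorem le_threeRegimeBound {r : ℝ} (hq : 1 ≤ q) (hb : 0 < b) (hn : 1 ≤ n) (hx : 0 < x)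
    (hr1 : r ≤ 1) (hr : ∀ p, q ≤ p → r ≤ (b ^ 2 * (p - 1) * n) ^ (p / 2) / x ^ p) :
    r ≤ threeRegimeBound q b n x := by
  have : (0 : ℝ) < n := by exact_mod_cast hn
  have : 0 ≤ q - 1 := sub_nonneg.2 hq
  rw [threeRegimeBound]
  split_ifs with hsmall hmid
  · exact hr1
  · exact hr q le_rfl
  · -- The exponent `p` balances the moment bound: `b ^ 2 * (p - 1) * n = x ^ 2 / e`.
    obtain ⟨p, hp⟩ : ∃ p, p = 1 + x ^ 2 / (Real.exp 1 * b ^ 2 * n) := ⟨_, rfl⟩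
    have hqp : q ≤ p := by
      rw [not_lt, mul_sqrt_le_iff hb.le (by positivity) hx.le] at hmid
      rw [hp, ← sub_le_iff_le_add', le_div_iff₀ (by positivity)]
      linarith
    have hbalance : b ^ 2 * (p - 1) * n = x ^ 2 / Real.exp 1 := by
      rw [hp]
      field_simp
      ring
    calc r ≤ (b ^ 2 * (p - 1) * n) ^ (p / 2) / x ^ p := hr p hqp
      _ = Real.exp (-(p / 2)) := by
        rw [hbalance, sq_div_rpow_half_div_rpow hx (Real.exp_pos 1).le, Real.exp_one_rpow]
      _ = 1 / √(Real.exp 1) * Real.exp (-(x ^ 2 / (2 * Real.exp 1 * b ^ 2 * n))) := by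
        rw [one_div_sqrt_exp_one_mul_exp_neg, hp]
        congr 1
        field_simp

theorem one_lt_two_mul_exp_neg_half (hu : u ≤ 1) : 1 < 2 * Real.exp (-(u / 2)) := by
  have hexp := Real.add_one_lt_exp (by norm_num : (-(1 / 2) : ℝ) ≠ 0)
  have hmono : Real.exp (-(1 / 2)) ≤ Real.exp (-(u / 2)) := Real.exp_le_exp.2 (by linarith)
  linarith

theorem sub_one_le_three_mul_log (hu : u ∈ Set.Icc 1 3) : u - 1 ≤ 3 * Real.log u := by
  have hu0 : 0 < u := one_pos.trans_le hu.1
  have hinv : 0 ≤ 3 * (1 - u⁻¹) - (u - 1) :=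
    calc 0 ≤ (u - 1) * (3 - u) / u :=
          div_nonneg (mul_nonneg (sub_nonneg.2 hu.1) (sub_nonneg.2 hu.2)) hu0.le
      _ = 3 * (1 - u⁻¹) - (u - 1) := by field_simp
  linarith [Real.one_sub_inv_le_log_of_pos hu0]

theorem rpow_neg_half_lt_two_mul_exp_neg_half (hq : 3 ≤ q) (hu : u ∈ Set.Icc 1 3) :
    u ^ (-(q / 2)) < 2 * Real.exp (-(u / 2)) := by
  have hlog : 3 * Real.log u ≤ q * Real.log u := by
    gcongr
    exact Real.log_nonneg hu.1
  calc u ^ (-(q / 2)) = Real.exp (-(q * Real.log u / 2)) := by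
        rw [Real.rpow_def_of_pos (one_pos.trans_le hu.1)]
        ring_nf
    _ ≤ Real.exp (1 / 2 + -(u / 2)) :=
        Real.exp_le_exp.2 (by linarith [sub_one_le_three_mul_log hu])
    _ = Real.exp (1 / 2) * Real.exp (-(u / 2)) := Real.exp_add _ _
    _ < 2 * Real.exp (-(u / 2)) := by
        gcongr
        have h := one_lt_two_mul_exp_neg_half le_rfl
        rwa [Real.exp_neg, ← div_eq_mul_inv, one_lt_div (Real.exp_pos _)] at h

theorem threeRegimeBound_lt_pinelisBound (hq : Real.exp 1 + 1 ≤ q) (hb : 0 < b) (hn : 1 ≤ n)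
    (hx : 0 < x) : threeRegimeBound q b n x < pinelisBound q b n x := by
  have : (0 : ℝ) < n := by exact_mod_cast hn
  have hq1 : 0 < q - 1 := by linarith [Real.exp_pos 1]
  obtain ⟨u, hu⟩ : ∃ u, u = x ^ 2 / (b ^ 2 * (q - 1) * n) := ⟨_, rfl⟩
  have hu0 : 0 < u := by rw [hu]; positivity
  have hregime {c : ℝ} (hc : 0 ≤ c) : x < b * √(c * (q - 1) * n) ↔ u < c := by
    rw [← not_le, mul_sqrt_le_iff hb.le (by positivity) hx.le, not_le, hu,
      div_lt_iff₀ (by positivity)]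
    ring_nf
  have hpinelis : pinelisBound q b n x = 2 * Real.exp (-(u / 2)) := by
    rw [pinelisBound, hu]
    congr 3
    field_simp
  rw [threeRegimeBound, hpinelis]
  split_ifs with hsmall hmid
  · rw [← one_mul (q - 1), hregime one_pos.le] at hsmall
    exact one_lt_two_mul_exp_neg_half hsmall.le
  · rw [← one_mul (q - 1), hregime one_pos.le, not_lt] at hsmall
    rw [hregime (Real.exp_pos 1).le] at hmid
    have hv : b ^ 2 * (q - 1) * n = x ^ 2 / u := by rw [hu]; field_simp
    rw [hv, sq_div_rpow_half_div_rpow hx hu0.le]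
    exact rpow_neg_half_lt_two_mul_exp_neg_half (by linarith [Real.exp_one_gt_d9])
      ⟨hsmall, hmid.le.trans (by linarith [Real.exp_one_lt_d9])⟩
  · have hexponent : u / 2 ≤ x ^ 2 / (2 * Real.exp 1 * b ^ 2 * n) :=
      calc u / 2 = x ^ 2 / (2 * (q - 1) * b ^ 2 * n) := by rw [hu]; field_simp
        _ ≤ x ^ 2 / (2 * Real.exp 1 * b ^ 2 * n) := by gcongr; linarith
    rw [one_div_sqrt_exp_one_mul_exp_neg]
    calc _ ≤ Real.exp (-(u / 2)) := Real.exp_le_exp.2 (by linarith)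
      _ < 2 * Real.exp (-(u / 2)) := lt_mul_of_one_lt_left (Real.exp_pos _) one_lt_two

end Bounds

theorem ae_norm_le_of_eLpNorm_top_le {Ω E : Type*} {mΩ : MeasurableSpace Ω} {P : Measure Ω}
    [NormedAddCommGroup E] {f : Ω → E} {b : ℝ} (hb : 0 ≤ b)
    (hf : eLpNorm f ⊤ P ≤ ENNReal.ofReal b) : ∀ᵐ ω ∂P, ‖f ω‖ ≤ b := by
  rw [eLpNorm_exponent_top] at hf
  filter_upwards [ae_le_eLpNormEssSup (f := f) (μ := P)] with ω hω
  rw [← ENNReal.ofReal_le_ofReal_iff hb, ofReal_norm]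
  exact hω.trans hf

theorem IsMartingaleDifference.measureReal_le_sup'_norm_partialSum_le_threeRegimeBound
    {Ω E : Type*} {mΩ : MeasurableSpace Ω} {P : Measure Ω} [IsProbabilityMeasure P]
    {ℱ : Filtration ℕ mΩ} [NormedAddCommGroup E] [NormedSpace ℝ E] [CompleteSpace E]
    {d : ℕ → Ω → E} {q b : ℝ} (hd : IsMartingaleDifference d ℱ P) (hq : 2 ≤ q)
    (hE : ∀ p, q ≤ p → TwoPointSmooth p (p - 1) E) (hb : 0 < b)
    (hdb : ∀ i, 1 ≤ i → ∀ᵐ ω ∂P, ‖d i ω‖ ≤ b) {n : ℕ} (hn : 1 ≤ n) {x : ℝ} (hx : 0 < x) :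
    P.real {ω | x ≤ (Finset.Icc 1 n).sup' (Finset.nonempty_Icc.mpr hn)
      (fun k => ‖partialSum d k ω‖)} ≤ threeRegimeBound q b n x :=
  le_threeRegimeBound (by linarith) hb hn hx measureReal_le_one fun p hqp =>
    hd.measureReal_le_sup'_norm_partialSum_le_of_bound (hE p hqp) (by linarith) (by linarith) hb.le
      hdb hn hx

theorem mainTheorem4_general {𝒳 Ω F : Type*} [MeasurableSpace 𝒳] (μ : Measure 𝒳)
    [NormedAddCommGroup F] [InnerProductSpace ℝ F] [CompleteSpace F] (q : ℝ) [hq : Fact (2 ≤ q)]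
    {mΩ : MeasurableSpace Ω} (P : Measure Ω) [IsProbabilityMeasure P] (ℱ : Filtration ℕ mΩ)
    (d : ℕ → Ω → Lp F (ENNReal.ofReal q) μ) (hd : IsMartingaleDifference d ℱ P)
    (b : ℝ) (hb : 0 < b)
    (hdb : ∀ i, 1 ≤ i → eLpNorm (fun ω => ‖d i ω‖) ⊤ P ≤ ENNReal.ofReal b) :
    (∀ (n : ℕ) (hn : 1 ≤ n) (x : ℝ), 0 < x →
      P.real {ω | x ≤ (Finset.Icc 1 n).sup' (Finset.nonempty_Icc.mpr hn)
        (fun k => ‖partialSum d k ω‖)} ≤ threeRegimeBound q b n x) ∧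
    (Real.exp 1 + 1 ≤ q → ∀ (n : ℕ) (x : ℝ), 1 ≤ n → 0 < x →
      threeRegimeBound q b n x < pinelisBound q b n x) := by
  have hsmooth (p : ℝ) (hqp : q ≤ p) : TwoPointSmooth p (p - 1) (Lp F (ENNReal.ofReal q) μ) :=
    have hp : 2 ≤ p := hq.out.trans hqp
    (twoPointSmooth_of_innerProductSpace hp).lp μ hqp (by linarith)
  have hbound (i : ℕ) (hi : 1 ≤ i) : ∀ᵐ ω ∂P, ‖d i ω‖ ≤ b :=
    ae_norm_le_of_eLpNorm_top_le hb.le (eLpNorm_norm (d i) ▸ hdb i hi)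
  exact ⟨fun n hn x hx => hd.measureReal_le_sup'_norm_partialSum_le_threeRegimeBound hq.out hsmooth
      hb hbound hn hx,
    fun hqe n x hn hx => threeRegimeBound_lt_pinelisBound hqe hb hn hx⟩

theorem mainTheorem4 {𝒳 Ω : Type*} [MeasurableSpace 𝒳] (μ : Measure 𝒳)
    (q : ℝ) [Fact (2 ≤ q)]
    {mΩ : MeasurableSpace Ω} (P : Measure Ω) [IsProbabilityMeasure P]
    (ℱ : Filtration ℕ mΩ) (d : ℕ → Ω → Lp ℝ (ENNReal.ofReal q) μ)
    (hd : IsMartingaleDifference d ℱ P)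
    (b : ℝ) (hb : 0 < b)
    (hdb : ∀ i, 1 ≤ i → eLpNorm (fun ω => ‖d i ω‖) ⊤ P ≤ ENNReal.ofReal b) :
    (∀ (n : ℕ) (hn : 1 ≤ n) (x : ℝ), 0 < x →
      P.real {ω | x ≤ (Finset.Icc 1 n).sup' (Finset.nonempty_Icc.mpr hn)
        (fun k => ‖partialSum d k ω‖)} ≤ threeRegimeBound q b n x) ∧
    (Real.exp 1 + 1 ≤ q → ∀ (n : ℕ) (x : ℝ), 1 ≤ n → 0 < x →
      threeRegimeBound q b n x < pinelisBound q b n x) :=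
  mainTheorem4_general μ q P ℱ d hd b hb hdb
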